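/- Let $(m,n)$ be positive integers with $n>1$, and with $n\ge 2m$ if $n$ is even. Let $(\mathbb{S}^n,g_0)$ be the standard unit sphere, $\Delta_0$ its positive Laplace–Beltrami operator, $d\mu_0$ its Riemannian measure, and let $$P_0=\prod_{k=1}^m\left[\Delta_0+\left(\frac n2-k\right)\left(\frac n2+k-1\right)\right]$$ be its Paneitz–Branson operator of order $2m$. For $u\in C^\infty(\mathbb{S}^n)$ let $Q(g_u)$ be the $2m$-th order $Q$-curvature of $g_u=e^{2u}g_0$, that is, $Q(g_u)=e^{-2mu}\left((2m-1)!+P_0[u]\right)$ if $n=2m$, and $\left(\frac n2-m\right)Q(g_u)=e^{-(\frac n2+m)u}P_0\left[e^{(\frac n2-m)u}\right]$ if $n\ne 2m$. Let $\mathbf{Q}:C^\infty(\mathbb{S}^n)\to C^\infty(\mathbb{S}^n)$ be the $Q$-curvature increment operator: $\mathbf{Q}[u]=Q(g_u)-Q(g_0)$ if $n=2m$, and $\mathbf{Q}[u]=\left(\frac n2-m\right)\left[Q(g_u)-Q(g_0)\right]$ if $n\neq 2m$. Then the linearization $L=d\mathbf{Q}[0]$, that is, the linear operator on $C^\infty(\mathbb{S}^n)$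 with $Lv=\frac{d}{dt}\mathbf{Q}[tv]\big|_{t=0}$ pointwise on $\mathbb{S}^n$ for every $v$, exists and is (formally) self-adjoint in $L^2(\mathbb{S}^n,d\mu_0)$: $$\int_{\mathbb{S}^n}(Lv)\,w\,d\mu_0=\int_{\mathbb{S}^n}v\,(Lw)\,d\mu_0\qquad\text{for all } v,w\in C^\infty(\mathbb{S}^n),$$ and $\operatorname{Ker}L=\Lambda_1$, where $\Lambda_1$ is the space of first spherical harmonics on $\mathbb{S}^n$ (the restrictions to $\mathbb{S}^n$ of the homogeneous harmonic polynomials of degree $1$ on $\mathbb{R}^{n+1}$), which has dimension $n+1$. -/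

import Mathlib

open scoped Manifold ContDiff

noncomputable section

namespace SphereQ

/-- The unit sphere `𝕊ⁿ` of `ℝⁿ⁺¹`. -/
abbrev Sph (n : ℕ) : Type := Metric.sphere (0 : EuclideanSpace ℝ (Fin (n + 1))) 1

/-- `C^∞(𝕊ⁿ)`, the algebra of smooth real-valued functions on the sphere. -/
abbrev Smooth (n : ℕ) : Type := C^∞⟮𝓡 n, Sph n; ℝ⟯

/-- The Lebesgue measure `dμ₀` of the round metric `g₀` (the surface measure of the unit sphere,
not normalized). -/
def μ₀ (n : ℕ) : MeasureTheory.Measure (Sph n) :=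
  (MeasureTheory.volume : MeasureTheory.Measure (EuclideanSpace ℝ (Fin (n + 1)))).toSphere

/-- The extension of `f : 𝕊ⁿ → ℝ` to `ℝⁿ⁺¹ ∖ {0}` that is constant along rays,
`y ↦ f (y / |y|)`. The value at the origin is irrelevant and set to `0`. -/
def radialExt {n : ℕ} (f : Sph n → ℝ) (y : EuclideanSpace ℝ (Fin (n + 1))) : ℝ :=
  if hy : y = 0 then 0 else
    f ⟨‖y‖⁻¹ • y, by
      rw [mem_sphere_zero_iff_norm, norm_smul, norm_inv, norm_norm,
        inv_mul_cancel₀ (norm_ne_zero_iff.mpr hy)]⟩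

theorem two_le_infty : (2 : WithTop ℕ∞) ≤ ∞ :=
  WithTop.coe_le_coe.mpr (le_top : (2 : ℕ∞) ≤ ⊤)

theorem contDiffAt_radialExt {n : ℕ} (f : Smooth n) {y : EuclideanSpace ℝ (Fin (n + 1))}
    (hy : y ≠ 0) : ContDiffAt ℝ ∞ (radialExt f) y := by
  have : Fact (Module.finrank ℝ (EuclideanSpace ℝ (Fin (n + 1))) = n + 1) :=
    ⟨finrank_euclideanSpace_fin⟩
  let U : TopologicalSpace.Opens (EuclideanSpace ℝ (Fin (n + 1))) :=
    ⟨{0}ᶜ, isOpen_compl_singleton⟩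
  have hU : ∀ z : U, (z : EuclideanSpace ℝ (Fin (n + 1))) ≠ 0 := fun z => z.2
  have hmem : ∀ z : U, ‖(z : EuclideanSpace ℝ (Fin (n + 1)))‖⁻¹ •
      (z : EuclideanSpace ℝ (Fin (n + 1))) ∈
        Metric.sphere (0 : EuclideanSpace ℝ (Fin (n + 1))) 1 := fun z => by
    rw [mem_sphere_zero_iff_norm, norm_smul, norm_inv, norm_norm,
      inv_mul_cancel₀ (norm_ne_zero_iff.mpr (hU z))]
  have hg : ContMDiff 𝓘(ℝ, EuclideanSpace ℝ (Fin (n + 1)))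
      𝓘(ℝ, EuclideanSpace ℝ (Fin (n + 1))) ∞
      (fun z : U => ‖(z : EuclideanSpace ℝ (Fin (n + 1)))‖⁻¹ •
        (z : EuclideanSpace ℝ (Fin (n + 1)))) := by
    intro z
    have h1 : ContDiffAt ℝ ∞ (fun w : EuclideanSpace ℝ (Fin (n + 1)) => ‖w‖⁻¹ • w)
        (z : EuclideanSpace ℝ (Fin (n + 1))) :=
      ((contDiffAt_norm ℝ (hU z)).inv (norm_ne_zero_iff.mpr (hU z))).smul contDiffAt_id
    exact contMDiffAt_subtype_iff.mpr h1.contMDiffAt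
  have hp := hg.codRestrict_sphere (n := n) hmem
  have hF := f.contMDiff.comp hp
  have hF' := hF ⟨y, hy⟩
  have hcongr : ∀ z : U, radialExt f (z : EuclideanSpace ℝ (Fin (n + 1))) =
      f ⟨_, hmem z⟩ := fun z => by
    simp [radialExt, hU z]
  have h2 : ContMDiffAt 𝓘(ℝ, EuclideanSpace ℝ (Fin (n + 1))) 𝓘(ℝ, ℝ) ∞
      (fun z : U => radialExt f (z : EuclideanSpace ℝ (Fin (n + 1)))) ⟨y, hy⟩ := by
    simp only [hcongr]
    exact hF'
  exact (contMDiffAt_subtype_iff.mp h2).contDiffAt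

theorem contDiffAt_laplacian {E : Type*} [NormedAddCommGroup E] [InnerProductSpace ℝ E]
    [FiniteDimensional ℝ E] {F : E → ℝ} {y : E} (hF : ContDiffAt ℝ ∞ F y) :
    ContDiffAt ℝ ∞ (Laplacian.laplacian F) y := by
  rw [InnerProductSpace.laplacian_eq_iteratedFDeriv_stdOrthonormalBasis]
  simp only [iteratedFDeriv_two_apply]
  have h1 : ContDiffAt ℝ ∞ (fderiv ℝ F) y := hF.fderiv_right (by simp)
  have h2 : ContDiffAt ℝ ∞ (fderiv ℝ (fderiv ℝ F)) y := h1.fderiv_right (by simp)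
  refine ContDiffAt.sum fun i _ => ?_
  exact (h2.clm_apply contDiffAt_const).clm_apply contDiffAt_const

theorem sph_ne_zero {n : ℕ} (x : Sph n) : (x : EuclideanSpace ℝ (Fin (n + 1))) ≠ 0 :=
  ne_zero_of_mem_unit_sphere x

theorem contMDiff_coe_sph (n : ℕ) :
    ContMDiff (𝓡 n) 𝓘(ℝ, EuclideanSpace ℝ (Fin (n + 1))) ∞
      (fun x : Sph n => (x : EuclideanSpace ℝ (Fin (n + 1)))) :=
  have : Fact (Module.finrank ℝ (EuclideanSpace ℝ (Fin (n + 1))) = n + 1) :=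
    ⟨finrank_euclideanSpace_fin⟩
  contMDiff_coe_sphere

/-- The positive Laplace–Beltrami operator `Δ₀` of the round metric `g₀` on `𝕊ⁿ`: minus the
restriction to the sphere of the Euclidean Laplacian of the extension `y ↦ f (y / |y|)`. -/
def Δ₀ (n : ℕ) : Smooth n →ₗ[ℝ] Smooth n where
  toFun f :=
    ⟨fun x => -Laplacian.laplacian (radialExt f) (x : EuclideanSpace ℝ (Fin (n + 1))),
      fun x => ((contDiffAt_laplacian
        (contDiffAt_radialExt f (sph_ne_zero x))).neg.contMDiffAt).comp x
          (contMDiff_coe_sph n x)⟩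
  map_add' f g := by
    ext x
    have h : radialExt ⇑(f + g) = radialExt f + radialExt g := by
      funext y
      by_cases hy : y = 0 <;> simp [radialExt, hy]
    have hf := (contDiffAt_radialExt f (sph_ne_zero x)).of_le (m := 2) two_le_infty
    have hg := (contDiffAt_radialExt g (sph_ne_zero x)).of_le (m := 2) two_le_infty
    change -Laplacian.laplacian (radialExt ⇑(f + g)) _ =
      -Laplacian.laplacian (radialExt f) _ + -Laplacian.laplacian (radialExt g) _
    rw [h, hf.laplacian_add hg]
    ring
  map_smul' c f := by
    ext x
    have h : radialExt ⇑(c • f) = c • radialExt f := by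
      funext y
      by_cases hy : y = 0 <;> simp [radialExt, hy]
    have hf := (contDiffAt_radialExt f (sph_ne_zero x)).of_le (m := 2) two_le_infty
    change -Laplacian.laplacian (radialExt ⇑(c • f)) _ =
      c • -Laplacian.laplacian (radialExt f) _
    rw [h, InnerProductSpace.laplacian_smul c hf, smul_neg]

/-- The exponential `e^f` of a smooth function. -/
def sexp {n : ℕ} (f : Smooth n) : Smooth n :=
  ⟨fun x => Real.exp (f x), Real.contDiff_exp.contMDiff.comp f.contMDiff⟩

/-- The pairs `(m, n)` under consideration. -/
structure Admissible (m n : ℕ) : Prop where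
  m_pos : 0 < m
  one_lt_n : 1 < n
  le_of_even : Even n → 2 * m ≤ n

/-- The polynomial `p₀(X) = ∏_{k=1}^m [X + (n/2 - k)(n/2 + k - 1)]`. -/
def p₀ (m n : ℕ) : Polynomial ℝ :=
  ∏ k ∈ Finset.Icc 1 m,
    (Polynomial.X + Polynomial.C (((n : ℝ) / 2 - k) * ((n : ℝ) / 2 + k - 1)))

/-- The Paneitz–Branson operator `P₀ = p₀(Δ₀)` of the round metric, of order `2m`. -/
def P₀ (m n : ℕ) : Smooth n →ₗ[ℝ] Smooth n :=
  Polynomial.aeval (R := ℝ) (A := Module.End ℝ (Smooth n)) (Δ₀ n) (p₀ m n)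

/-- The Paneitz–Branson operator of `g_u = e^{2u} g₀`:
`P_u(w) = e^{-(n/2+m)u} P₀[e^{(n/2-m)u} w]`. -/
def P (m n : ℕ) (u w : Smooth n) : Smooth n :=
  sexp (-((n : ℝ) / 2 + m) • u) * P₀ m n (sexp (((n : ℝ) / 2 - m) • u) * w)

/-- The `Q`-curvature `Q(g_u)` of `g_u = e^{2u} g₀`:
`e^{-2mu} ((2m-1)! + P₀[u])` if `n = 2m`; otherwise given by `(n/2 - m) Q(g_u) = P_u(1)`. -/
def Qcurv (m n : ℕ) (u : Smooth n) : Smooth n :=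
  if n = 2 * m then
    sexp (-(2 * (m : ℝ)) • u) *
      (((Nat.factorial (2 * m - 1) : ℕ) : ℝ) • (1 : Smooth n) + P₀ m n u)
  else ((n : ℝ) / 2 - m)⁻¹ • P m n u 1

/-- The (renormalized) conformal `Q`-curvature increment operator:
`Q(g_u) - Q(g₀)` if `n = 2m`, and `(n/2 - m) (Q(g_u) - Q(g₀))` otherwise. -/
def Qincr (m n : ℕ) (u : Smooth n) : Smooth n :=
  if n = 2 * m then Qcurv m n u - Qcurv m n 0
  else ((n : ℝ) / 2 - m) • (Qcurv m n u - Qcurv m n 0)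

/-- `L` is the linearization `dQ[u]` of `Q : C^∞(𝕊ⁿ) → C^∞(𝕊ⁿ)` at `u`:
`L v = d/dt Q[u + t v]` at `t = 0`, for every direction `v`. At most one `L` has this property. -/
def IsLinearizationAt {n : ℕ} (Q : Smooth n → Smooth n) (u : Smooth n)
    (L : Smooth n →ₗ[ℝ] Smooth n) : Prop :=
  ∀ (v : Smooth n) (x : Sph n), HasDerivAt (fun t : ℝ => Q (u + t • v) x) (L v x) 0

/-- Self-adjointness in `L²(𝕊ⁿ, dμ₀)` of a linear operator on `C^∞(𝕊ⁿ)`. -/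
def IsSelfAdjointL2 {n : ℕ} (L : Smooth n →ₗ[ℝ] Smooth n) : Prop :=
  ∀ v w : Smooth n, ∫ x, L v x * w x ∂(μ₀ n) = ∫ x, v x * L w x ∂(μ₀ n)

/-- `Λ_i`, the space of `i`-th spherical harmonics on `𝕊ⁿ`: the restrictions to the sphere of the
harmonic homogeneous polynomials of degree `i` in `n + 1` variables. -/
def Λ (n i : ℕ) : Submodule ℝ (Smooth n) where
  carrier := {f | ∃ p : MvPolynomial (Fin (n + 1)) ℝ, p.IsHomogeneous i ∧
    ∑ j, MvPolynomial.pderiv j (MvPolynomial.pderiv j p) = 0 ∧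
    ∀ x : Sph n, f x =
      MvPolynomial.eval (fun j => (x : EuclideanSpace ℝ (Fin (n + 1))) j) p}
  add_mem' := by
    rintro f g ⟨p, hp, hp', hfp⟩ ⟨q, hq, hq', hgq⟩
    refine ⟨p + q, hp.add hq, ?_, fun x => ?_⟩
    · simp only [map_add, Finset.sum_add_distrib, hp', hq', add_zero]
    · simp [hfp, hgq]
  zero_mem' := ⟨0, MvPolynomial.isHomogeneous_zero _ _ _, by simp, fun x => by simp⟩
  smul_mem' := by
    rintro c f ⟨p, hp, hp', hfp⟩
    refine ⟨c • p, ?_, ?_, fun x => ?_⟩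
    · exact (MvPolynomial.homogeneousSubmodule (Fin (n + 1)) ℝ i).smul_mem c hp
    · simp only [Derivation.map_smul, ← Finset.smul_sum, hp', smul_zero]
    · simp [hfp]

end SphereQ

end

/-! The linearization is a polynomial in the Laplacian, $L=q(\Delta_0)$ with $q=\alpha p_0-\beta$.
In the critical case the product rule gives $\alpha=1$, $\beta=(2m)!$; otherwise $\alpha=\frac
n2-m$, $\beta=(\frac n2+m)\,p_0(0)$. The only analytic point is
$\frac{d}{dt}P_0[e^{tw}]|_{t=0}=P_0w$, which is done algebraically in `expCurves`. Self-adjointness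
of $L$ reduces to that of $\Delta_0$, which follows from the divergence theorem on $\mathbb R^{n+1}$
for homogeneous extensions (`isSelfAdjointL2_Δ₀`).

For the kernel, put $\lambda_i=i(i+n-1)$ and $F(s)=\prod_{k\le m}(s-k)(s+k-1)$, so that
$p_0(\lambda_i)=F(\frac n2+i)$. The recurrence $(s-m)F(s+1)=(s+m)F(s)$ (and $F(m+1)=(2m)!$ if
$n=2m$) yields $\beta=\alpha F(\frac n2+1)$, and also shows that $|F(\frac n2+i)|$ is strictly
increasing in $i$. Hence $q(\lambda_i)=0$ exactly when $i=1$ (`linPoly_eval_eigen`).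

No spectral decomposition is needed. $\Delta_0$ preserves the filtration of polynomials by degree
and acts as $\lambda_k$ on the degree-$k$ quotient (`Δ₀_sub_eigen_mem`). If
$v\in\operatorname{Ker}L$ is orthogonal to the coordinates, then by symmetry and induction on the
degree it is orthogonal to all polynomials (`l2Form_polyLT_eq_zero`), so $v=0$ by Stone–Weierstrass.
-/

namespace SphereQ

/-! ### Rules for the Euclidean Laplacian. -/

section Euclidean

variable {E : Type*} [NormedAddCommGroup E] [InnerProductSpace ℝ E]

theorem eventually_differentiableAt {F : E → ℝ} {y : E} (hF : ContDiffAt ℝ 2 F y) :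
    ∀ᶠ z in nhds y, DifferentiableAt ℝ F z := by
  filter_upwards [hF.eventually (by simp)] with z hz using hz.differentiableAt (by simp)

theorem differentiableAt_fderiv {F : E → ℝ} {y : E} (hF : ContDiffAt ℝ 2 F y) :
    DifferentiableAt ℝ (fderiv ℝ F) y :=
  (hF.fderiv_right (m := 1) (by norm_num)).differentiableAt (by simp)

theorem hasFDerivAt_inv_norm {y : E} (hy : ‖y‖ = 1) :
    HasFDerivAt (fun z : E => ‖z‖⁻¹) (-innerSL ℝ y) y := by
  have h0 : HasFDerivAt (fun z : E => ‖z‖ ^ 2) (2 • innerSL ℝ y) y :=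
    (hasStrictFDerivAt_norm_sq y).hasFDerivAt
  have h1 : HasDerivAt (fun t : ℝ => (√t)⁻¹) (-1 / 2) (‖y‖ ^ 2) := by
    have := (Real.hasDerivAt_sqrt (x := 1) one_ne_zero).inv (by simp)
    have h2 : (-(1 / (2 * √1)) / √1 ^ 2 : ℝ) = -1 / 2 := by norm_num
    rw [h2] at this
    rw [hy, one_pow]
    exact this
  have h2 := h1.comp_hasFDerivAt y h0
  have h3 : (fun z : E => ‖z‖⁻¹) = (fun t : ℝ => (√t)⁻¹) ∘ fun z => ‖z‖ ^ 2 := by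
    funext z
    simp
  have h4 : -innerSL ℝ y = (-1 / 2 : ℝ) • 2 • innerSL ℝ y := by
    ext v
    simp
    ring
  rw [h3, h4]
  exact h2

variable [FiniteDimensional ℝ E] {ι : Type*} [Fintype ι]

theorem laplacian_eq_sum_fderiv (b : OrthonormalBasis ι ℝ E) (F : E → ℝ) (y : E) :
    Laplacian.laplacian F y = ∑ i, fderiv ℝ (fderiv ℝ F) y (b i) (b i) := by
  rw [InnerProductSpace.laplacian_eq_iteratedFDeriv_orthonormalBasis F b]
  simp [iteratedFDeriv_two_apply]

theorem laplacian_mul (b : OrthonormalBasis ι ℝ E) {F G : E → ℝ} {y : E}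
    (hF : ContDiffAt ℝ 2 F y) (hG : ContDiffAt ℝ 2 G y) :
    Laplacian.laplacian (F * G) y = F y * Laplacian.laplacian G y +
      G y * Laplacian.laplacian F y + 2 * ∑ i, fderiv ℝ F y (b i) * fderiv ℝ G y (b i) := by
  have h : fderiv ℝ (F * G) =ᶠ[nhds y] fun z => F z • fderiv ℝ G z + G z • fderiv ℝ F z := by
    filter_upwards [eventually_differentiableAt hF, eventually_differentiableAt hG] with z h1 h2
    exact fderiv_mul h1 h2
  have hF' := (hF.differentiableAt (by simp)).hasFDerivAt
  have hG' := (hG.differentiableAt (by simp)).hasFDerivAt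
  have hF2 := (differentiableAt_fderiv hF).hasFDerivAt
  have hG2 := (differentiableAt_fderiv hG).hasFDerivAt
  have h2 : fderiv ℝ (fderiv ℝ (F * G)) y = _ :=
    h.fderiv_eq.trans ((hF'.smul hG2).add (hG'.smul hF2)).fderiv
  simp only [laplacian_eq_sum_fderiv b, h2, Finset.mul_sum, ← Finset.sum_add_distrib]
  refine Finset.sum_congr rfl fun i _ => ?_
  simp
  ring

theorem laplacian_exp (b : OrthonormalBasis ι ℝ E) {F : E → ℝ} {y : E}
    (hF : ContDiffAt ℝ 2 F y) :
    Laplacian.laplacian (fun z => Real.exp (F z)) y = Real.exp (F y) *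
      (Laplacian.laplacian F y + ∑ i, fderiv ℝ F y (b i) * fderiv ℝ F y (b i)) := by
  have h : fderiv ℝ (fun z => Real.exp (F z)) =ᶠ[nhds y]
      fun z => Real.exp (F z) • fderiv ℝ F z := by
    filter_upwards [eventually_differentiableAt hF] with z h1
    exact h1.hasFDerivAt.exp.fderiv
  have hF' := (hF.differentiableAt (by simp)).hasFDerivAt
  have hF2 := (differentiableAt_fderiv hF).hasFDerivAt
  have h2 : fderiv ℝ (fderiv ℝ (fun z => Real.exp (F z))) y = _ :=
    h.fderiv_eq.trans (hF'.exp.smul hF2).fderiv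
  simp only [laplacian_eq_sum_fderiv b, h2, Finset.mul_sum, ← Finset.sum_add_distrib]
  refine Finset.sum_congr rfl fun i _ => ?_
  simp
  ring

theorem laplacian_comp_smul (F : E → ℝ) (c : ℝ) (y : E) :
    Laplacian.laplacian (fun z => F (c • z)) y = c ^ 2 * Laplacian.laplacian F (c • y) := by
  have h : fderiv ℝ (fun z => F (c • z)) = fun z => c • (fderiv ℝ F (c • z)) :=
    funext fun z => fderiv_comp_smul c
  simp only [laplacian_eq_sum_fderiv (stdOrthonormalBasis ℝ E), h, Finset.mul_sum]
  refine Finset.sum_congr rfl fun i _ => ?_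
  have h2 : fderiv ℝ (fun z => c • (fderiv ℝ F (c • z))) y =
      c • c • fderiv ℝ (fderiv ℝ F) (c • y) := by
    rw [← fderiv_comp_smul (f := fderiv ℝ F)]
    exact congrFun (fderiv_const_smul_field (f := fun z => fderiv ℝ F (c • z)) c) y
  rw [h2]
  simp
  ring

end Euclidean

/-! ### Calculus of $\Delta_0$ and its carré du champ. -/

variable {n : ℕ}

/-- The standard orthonormal basis of `ℝⁿ⁺¹`. -/
noncomputable abbrev stdBasis (n : ℕ) :
    OrthonormalBasis (Fin (n + 1)) ℝ (EuclideanSpace ℝ (Fin (n + 1))) :=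
  EuclideanSpace.basisFun (Fin (n + 1)) ℝ

theorem eventually_ne_sph (x : Sph n) :
    ∀ᶠ z in nhds (x : EuclideanSpace ℝ (Fin (n + 1))), z ≠ 0 :=
  isOpen_ne.mem_nhds (sph_ne_zero x)

theorem radialExt_coe (f : Sph n → ℝ) (x : Sph n) : radialExt f x = f x := by
  have : ‖(x : EuclideanSpace ℝ (Fin (n + 1)))‖ = 1 := by simp
  simp [radialExt, sph_ne_zero]

theorem radialExt_smul (f : Sph n → ℝ) {c : ℝ} (hc : 0 < c) (y : EuclideanSpace ℝ (Fin (n + 1))) :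
    radialExt f (c • y) = radialExt f y := by
  by_cases hy : y = 0
  · simp [hy]
  · simp only [radialExt, smul_eq_zero, hc.ne', hy, or_self, dite_false]
    congr 2
    rw [norm_smul, Real.norm_of_nonneg hc.le, smul_smul, mul_inv_rev, mul_assoc,
      inv_mul_cancel₀ hc.ne', mul_one]

theorem radialExt_mul (f g : Smooth n) : radialExt ⇑(f * g) = radialExt f * radialExt g := by
  funext y
  by_cases hy : y = 0 <;> simp [radialExt, hy]

theorem contDiffAt_two_radialExt (f : Smooth n) (x : Sph n) :
    ContDiffAt ℝ 2 (radialExt f) (x : EuclideanSpace ℝ (Fin (n + 1))) :=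
  (contDiffAt_radialExt f (sph_ne_zero x)).of_le two_le_infty

theorem Δ₀_apply (f : Smooth n) (x : Sph n) :
    Δ₀ n f x = -Laplacian.laplacian (radialExt f) (x : EuclideanSpace ℝ (Fin (n + 1))) := rfl

/-- The carré du champ `⟨∇f, ∇g⟩` of the round metric. -/
noncomputable def carre (f g : Smooth n) : Smooth n :=
  (1 / 2 : ℝ) • (f * Δ₀ n g + g * Δ₀ n f - Δ₀ n (f * g))

/-- In the Leibniz rule for the Laplacian of a product the second-order terms cancel, leaving the
gradient pairing. This makes `carre` a derivation in each argument. -/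
theorem carre_apply (f g : Smooth n) (x : Sph n) :
    carre f g x = ∑ i, fderiv ℝ (radialExt f) x (stdBasis n i) *
      fderiv ℝ (radialExt g) x (stdBasis n i) := by
  have h := laplacian_mul (stdBasis n) (contDiffAt_two_radialExt f x)
    (contDiffAt_two_radialExt g x)
  rw [radialExt_coe, radialExt_coe, ← radialExt_mul] at h
  change (1 / 2 : ℝ) * (f x * Δ₀ n g x + g x * Δ₀ n f x - Δ₀ n (f * g) x) = _
  simp only [Δ₀_apply, h]
  ring

theorem Δ₀_mul (f g : Smooth n) :
    Δ₀ n (f * g) = f * Δ₀ n g + g * Δ₀ n f - (2 : ℝ) • carre f g := by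
  simp [carre, smul_smul]

theorem carre_comm (f g : Smooth n) : carre f g = carre g f := by
  simp only [carre, mul_comm f g]
  congr 2
  exact add_comm _ _

theorem carre_add (f g h : Smooth n) : carre f (g + h) = carre f g + carre f h := by
  simp only [carre, map_add, mul_add, add_mul, ← smul_add]
  congr 1
  ring

theorem carre_smul (c : ℝ) (f g : Smooth n) : carre f (c • g) = c • carre f g := by
  simp only [carre, map_smul, mul_smul_comm, smul_mul_assoc, smul_sub, smul_add, smul_comm c]

theorem carre_mul (f g h : Smooth n) : carre f (g * h) = g * carre f h + h * carre f g := by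
  ext x
  change carre f (g * h) x = g x * carre f h x + h x * carre f g x
  have h1 := fderiv_mul ((contDiffAt_two_radialExt g x).differentiableAt (by simp))
    ((contDiffAt_two_radialExt h x).differentiableAt (by simp))
  simp only [carre_apply, radialExt_mul, h1, radialExt_coe, Finset.mul_sum,
    ← Finset.sum_add_distrib]
  refine Finset.sum_congr rfl fun i _ => ?_
  simp
  ring

theorem radialExt_sexp (f : Smooth n) (x : Sph n) :
    radialExt (sexp f) =ᶠ[nhds (x : EuclideanSpace ℝ (Fin (n + 1)))]
      fun z => Real.exp (radialExt f z) := by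
  filter_upwards [eventually_ne_sph x] with z hz
  simp only [radialExt, hz, dite_false]
  rfl

theorem Δ₀_sexp (f : Smooth n) : Δ₀ n (sexp f) = sexp f * (Δ₀ n f - carre f f) := by
  ext x
  change Δ₀ n (sexp f) x = Real.exp (f x) * (Δ₀ n f x - carre f f x)
  rw [Δ₀_apply, (InnerProductSpace.laplacian_congr_nhds (radialExt_sexp f x)).eq_of_nhds,
    laplacian_exp (stdBasis n) (contDiffAt_two_radialExt f x), radialExt_coe, carre_apply, Δ₀_apply]
  ring

theorem carre_sexp (f g : Smooth n) : carre (sexp f) g = sexp f * carre f g := by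
  ext x
  change carre (sexp f) g x = Real.exp (f x) * carre f g x
  have h1 : fderiv ℝ (radialExt (sexp f)) x = _ := (radialExt_sexp f x).fderiv_eq.trans
    ((contDiffAt_two_radialExt f x).differentiableAt (by simp)).hasFDerivAt.exp.fderiv
  simp only [carre_apply, h1, Finset.mul_sum, radialExt_coe]
  refine Finset.sum_congr rfl fun i _ => ?_
  simp
  ring

theorem Δ₀_one : Δ₀ n 1 = 0 := by
  ext x
  have h : radialExt ⇑(1 : Smooth n) =ᶠ[nhds (x : EuclideanSpace ℝ (Fin (n + 1)))]
      fun _ => 1 := by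
    filter_upwards [eventually_ne_sph x] with z hz
    simp [radialExt, hz]
  rw [Δ₀_apply, (InnerProductSpace.laplacian_congr_nhds h).eq_of_nhds]
  simp

/-! ### The coordinate functions. -/

/-- The `i`-th coordinate of `ℝⁿ⁺¹`. -/
noncomputable abbrev coordCLM (i : Fin (n + 1)) : EuclideanSpace ℝ (Fin (n + 1)) →L[ℝ] ℝ :=
  EuclideanSpace.proj i

/-- The restriction to the sphere of the `i`-th coordinate. -/
def coord (i : Fin (n + 1)) : Smooth n :=
  ⟨fun x => (x : EuclideanSpace ℝ (Fin (n + 1))) i,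
    ((coordCLM i).contDiff.contMDiff).comp
      (contMDiff_coe_sph n)⟩

theorem coord_apply (i : Fin (n + 1)) (x : Sph n) :
    coord i x = (x : EuclideanSpace ℝ (Fin (n + 1))) i := rfl

theorem sum_coord_sq : ∑ i : Fin (n + 1), coord i * coord i = (1 : Smooth n) := by
  ext x
  have h : ‖(x : EuclideanSpace ℝ (Fin (n + 1)))‖ ^ 2 = 1 := by simp
  rw [EuclideanSpace.norm_sq_eq] at h
  have h2 : (∑ i : Fin (n + 1), coord i * coord i : Smooth n) x =
      ∑ i : Fin (n + 1), coord i x * coord i x := by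
    change ContMDiffMap.evalRingHom x _ = _
    rw [map_sum]
    rfl
  rw [h2]
  simpa [coord_apply, sq] using h

theorem radialExt_coord (i : Fin (n + 1)) :
    radialExt ⇑(coord i) = (fun y => ‖y‖⁻¹) * ⇑(coordCLM i) := by
  funext y
  by_cases hy : y = 0 <;> simp [radialExt, hy, coord_apply]

theorem fderiv_radialExt_coord (i j : Fin (n + 1)) (x : Sph n) :
    fderiv ℝ (radialExt ⇑(coord i)) x (stdBasis n j) =
      (if i = j then 1 else 0) - coord i x * coord j x := by
  have hx : ‖(x : EuclideanSpace ℝ (Fin (n + 1)))‖ = 1 := by simp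
  have h := ((hasFDerivAt_inv_norm hx).mul (coordCLM i).hasFDerivAt).fderiv
  rw [radialExt_coord]
  erw [h]
  simp [hx, coord_apply, EuclideanSpace.inner_single_right]
  ring

/-- The tangential gradient of $x_i$ is $e_i-x_i\,x$. -/
theorem carre_coord (i j : Fin (n + 1)) :
    carre (coord i) (coord j) = (if i = j then (1 : ℝ) else 0) • (1 : Smooth n) -
      coord i * coord j := by
  ext x
  change carre (coord i) (coord j) x = (if i = j then (1 : ℝ) else 0) * 1 - coord i x * coord j x
  have h := congrArg (fun f : Smooth n => ContMDiffMap.evalRingHom x f) (sum_coord_sq (n := n))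
  simp only [map_sum, map_mul, map_one] at h
  change ∑ k, coord k x * coord k x = 1 at h
  rw [carre_apply]
  simp only [fderiv_radialExt_coord, sub_mul, mul_sub, Finset.sum_sub_distrib]
  have h3 : ∑ k, coord i x * coord k x * (coord j x * coord k x) = coord i x * coord j x := by
    calc _ = ∑ k, coord i x * coord j x * (coord k x * coord k x) :=
          Finset.sum_congr rfl fun k _ => by ring
      _ = _ := by rw [← Finset.mul_sum, h]; exact mul_one _
  rw [h3]
  simp
  ring

theorem Δ₀_coord (i : Fin (n + 1)) : Δ₀ n (coord i) = (n : ℝ) • coord i := by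
  ext x
  have hx : ‖(x : EuclideanSpace ℝ (Fin (n + 1)))‖ = 1 := by simp
  -- The product rule for $|y|^{-1}y_i$ gives a factor independent of $i$. Its value is found below,
  -- without computing $\Delta|y|^{-1}$, by applying $\Delta_0$ to $\sum x_i^2=1$: this reads
  -- $2c+2-2(n+1)=0$.
  obtain ⟨c, hc⟩ : ∃ c : ℝ, ∀ i, Δ₀ n (coord i) x = c * coord i x := by
    refine ⟨2 - Laplacian.laplacian
      (fun y : EuclideanSpace ℝ (Fin (n + 1)) => ‖y‖⁻¹) x, fun i => ?_⟩
    have h1 : ContDiffAt ℝ 2 (fun y : EuclideanSpace ℝ (Fin (n + 1)) => ‖y‖⁻¹) x :=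
      (contDiffAt_norm ℝ (sph_ne_zero x)).inv (by simp)
    set p := coordCLM i with hp
    have h2 : ContDiffAt ℝ 2 (⇑p) (x : EuclideanSpace ℝ (Fin (n + 1))) :=
      p.contDiff.contDiffAt
    have h3 : Laplacian.laplacian (⇑p) (x : EuclideanSpace ℝ (Fin (n + 1))) = 0 := by
      rw [laplacian_eq_sum_fderiv (stdBasis n)]
      have : fderiv ℝ (⇑p) = fun _ => p := funext fun z => p.fderiv
      simp [this]
    rw [Δ₀_apply, radialExt_coord, laplacian_mul (stdBasis n) h1 h2, h3,
      (hasFDerivAt_inv_norm hx).fderiv, p.fderiv]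
    simp [hp, coord_apply, EuclideanSpace.inner_single_right]
    ring
  have h := congrArg (fun f : Smooth n => ContMDiffMap.evalRingHom x f) (sum_coord_sq (n := n))
  simp only [map_sum, map_mul, map_one] at h
  change ∑ k, coord k x * coord k x = 1 at h
  have h0 := congrArg (fun f : Smooth n => ContMDiffMap.evalRingHom x (Δ₀ n f))
    (sum_coord_sq (n := n))
  simp only [map_sum, Δ₀_mul, Δ₀_one, map_zero] at h0
  have h1 : ∀ k, ContMDiffMap.evalRingHom x (coord k * Δ₀ n (coord k) + coord k * Δ₀ n (coord k) -
      (2 : ℝ) • carre (coord k) (coord k)) = (2 * c + 2) * (coord k x * coord k x) - 2 := by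
    intro k
    change coord k x * Δ₀ n (coord k) x + coord k x * Δ₀ n (coord k) x -
      2 * carre (coord k) (coord k) x = _
    rw [hc, carre_coord]
    change _ - 2 * ((if k = k then (1 : ℝ) else 0) * 1 - coord k x * coord k x) = _
    simp
    ring
  simp only [h1, Finset.sum_sub_distrib, ← Finset.mul_sum, h] at h0
  simp at h0
  have : c = n := by linarith
  rw [hc, this]
  rfl

/-! ### Differentiating $p(\Delta_0)[e^{tw}g]$ at $t=0$. -/

theorem Δ₀_sexp_mul (w g : Smooth n) (t : ℝ) :
    Δ₀ n (sexp (t • w) * g) = sexp (t • w) * Δ₀ n g +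
      t • (sexp (t • w) * (g * Δ₀ n w - (2 : ℝ) • carre w g)) -
      t ^ 2 • (sexp (t • w) * (g * carre w w)) := by
  rw [Δ₀_mul, Δ₀_sexp, carre_sexp, carre_smul, carre_comm (t • w) w, carre_smul,
    carre_comm (t • w) g, carre_smul, carre_comm g w, map_smul]
  simp only [Algebra.smul_def, map_pow]
  ring

/-- Pairs of a curve in `C^∞(𝕊ⁿ)`, a combination of the curves `t ↦ tⁱ e^{tw} g`, and of its
derivative at `0`. -/
noncomputable def expCurves (w : Smooth n) : Submodule ℝ ((ℝ → Smooth n) × Smooth n) :=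
  Submodule.span ℝ
    (Set.range (fun g => (fun t => sexp (t • w) * g, w * g)) ∪
      Set.range (fun g => (fun t => t • (sexp (t • w) * g), g)) ∪
      Set.range (fun ig : ℕ × Smooth n => (fun t => t ^ (ig.1 + 2) • (sexp (t • w) * ig.2), 0)))

section expCurves

variable {w : Smooth n}

theorem expCurves_zero (g : Smooth n) :
    ((fun t => sexp (t • w) * g, w * g) : (ℝ → Smooth n) × Smooth n) ∈ expCurves w :=
  Submodule.subset_span (Or.inl (Or.inl ⟨g, rfl⟩))

theorem expCurves_one (g : Smooth n) :
    ((fun t => t • (sexp (t • w) * g), g) : (ℝ → Smooth n) × Smooth n) ∈ expCurves w :=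
  Submodule.subset_span (Or.inl (Or.inr ⟨g, rfl⟩))

theorem expCurves_add_two (i : ℕ) (g : Smooth n) :
    ((fun t => t ^ (i + 2) • (sexp (t • w) * g), 0) : (ℝ → Smooth n) × Smooth n) ∈
      expCurves w :=
  Submodule.subset_span (Or.inr ⟨(i, g), rfl⟩)

/-- $\Delta_0(e^{tw}g)$ is $e^{tw}$ times a quadratic polynomial in $t$, so the span is stable under
$\Delta_0$, and the recorded derivative is transformed by $\Delta_0$ too. Thus $d/dt$ and $\Delta_0$
commute on these curves with no topology on $C^\infty$. -/
theorem expCurves_Δ₀ {c : (ℝ → Smooth n) × Smooth n} (hc : c ∈ expCurves w) :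
    ((fun t => Δ₀ n (c.1 t), Δ₀ n c.2) : (ℝ → Smooth n) × Smooth n) ∈ expCurves w := by
  induction hc using Submodule.span_induction with
  | mem c hc =>
    obtain ((⟨g, rfl⟩ | ⟨g, rfl⟩) | ⟨⟨i, g⟩, rfl⟩) := hc
    · convert Submodule.sub_mem _ (Submodule.add_mem _ (expCurves_zero (w := w) (Δ₀ n g))
        (expCurves_one (g * Δ₀ n w - (2 : ℝ) • carre w g)))
        (expCurves_add_two 0 (g * carre w w)) using 1
      refine Prod.ext (funext fun t => Δ₀_sexp_mul w g t) ?_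
      change Δ₀ n (w * g) = w * Δ₀ n g + (g * Δ₀ n w - (2 : ℝ) • carre w g) - 0
      rw [Δ₀_mul]
      ring
    · convert Submodule.sub_mem _ (Submodule.add_mem _ (expCurves_one (w := w) (Δ₀ n g))
        (expCurves_add_two 0 (g * Δ₀ n w - (2 : ℝ) • carre w g)))
        (expCurves_add_two 1 (g * carre w w)) using 1
      refine Prod.ext (funext fun t => ?_) ?_
      · change Δ₀ n (t • (sexp (t • w) * g)) = t • (sexp (t • w) * Δ₀ n g) +
          t ^ 2 • (sexp (t • w) * (g * Δ₀ n w - (2 : ℝ) • carre w g)) -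
          t ^ 3 • (sexp (t • w) * (g * carre w w))
        rw [map_smul, Δ₀_sexp_mul]
        module
      · change Δ₀ n g = Δ₀ n g + 0 - 0
        simp
    · convert Submodule.sub_mem _ (Submodule.add_mem _ (expCurves_add_two (w := w) i (Δ₀ n g))
        (expCurves_add_two (i + 1) (g * Δ₀ n w - (2 : ℝ) • carre w g)))
        (expCurves_add_two (i + 2) (g * carre w w)) using 1
      refine Prod.ext (funext fun t => ?_) ?_
      · change Δ₀ n (t ^ (i + 2) • (sexp (t • w) * g)) = t ^ (i + 2) • (sexp (t • w) * Δ₀ n g) +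
          t ^ (i + 1 + 2) • (sexp (t • w) * (g * Δ₀ n w - (2 : ℝ) • carre w g)) -
          t ^ (i + 2 + 2) • (sexp (t • w) * (g * carre w w))
        rw [map_smul, Δ₀_sexp_mul]
        module
      · change Δ₀ n 0 = 0 + 0 - 0
        simp
  | zero =>
    convert Submodule.zero_mem _ using 1
    simp
    rfl
  | add a b _ _ ha hb =>
    convert Submodule.add_mem _ ha hb using 1
    refine Prod.ext (funext fun t => map_add _ _ _) (map_add _ _ _)
  | smul r a _ ha =>
    convert Submodule.smul_mem _ r ha using 1
    refine Prod.ext (funext fun t => map_smul (Δ₀ n) r (a.1 t)) (map_smul (Δ₀ n) r a.2)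

theorem expCurves_aeval_Δ₀ (p : Polynomial ℝ) {c : (ℝ → Smooth n) × Smooth n}
    (hc : c ∈ expCurves w) :
    ((fun t => Polynomial.aeval (Δ₀ n) p (c.1 t), Polynomial.aeval (Δ₀ n) p c.2) :
      (ℝ → Smooth n) × Smooth n) ∈ expCurves w := by
  induction p using Polynomial.induction_on' generalizing c with
  | add p q hp hq =>
    convert Submodule.add_mem _ (hp hc) (hq hc) using 1
    simp only [map_add]
    rfl
  | monomial k a =>
    induction k generalizing c with
    | zero =>
      convert Submodule.smul_mem _ a hc using 1
      simp
      rfl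
    | succ k ih =>
      convert ih (expCurves_Δ₀ hc) using 1
      simp [Polynomial.aeval_monomial, pow_succ]

theorem expCurves_hasDerivAt {c : (ℝ → Smooth n) × Smooth n} (hc : c ∈ expCurves w) (x : Sph n) :
    HasDerivAt (fun t => c.1 t x) (c.2 x) 0 := by
  have he (g : Smooth n) : HasDerivAt (fun t : ℝ => Real.exp (t * w x) * g x) (w x * g x) 0 := by
    have := (((hasDerivAt_id (0 : ℝ)).mul_const (w x)).exp).mul_const (g x)
    simpa using this
  induction hc using Submodule.span_induction with
  | mem c hc =>
    obtain ((⟨g, rfl⟩ | ⟨g, rfl⟩) | ⟨⟨i, g⟩, rfl⟩) := hc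
    · exact he g
    · exact ((hasDerivAt_id (0 : ℝ)).mul (he g)).congr_deriv (by simp)
    · exact ((hasDerivAt_pow (i + 2) (0 : ℝ)).mul (he g)).congr_deriv (by simp)
  | zero => exact hasDerivAt_const _ _
  | add a b _ _ ha hb => exact ha.add hb
  | smul r a _ ha => exact ha.const_mul r

end expCurves

/-! ### The linearization as a polynomial in $\Delta_0$. -/

theorem sexp_zero : sexp (0 : Smooth n) = 1 := by
  ext x
  exact Real.exp_zero

theorem hasDerivAt_P₀_sexp (m : ℕ) (w : Smooth n) (x : Sph n) :
    HasDerivAt (fun t : ℝ => P₀ m n (sexp (t • w)) x) (P₀ m n w x) 0 := by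
  have := expCurves_hasDerivAt (expCurves_aeval_Δ₀ (p₀ m n) (expCurves_zero (w := w) 1)) x
  simp only [mul_one] at this
  exact this

/-- Since $\Delta_0 1=0$, only the constant term of $p_0$ survives. -/
theorem P₀_one (m : ℕ) : P₀ m n 1 = (p₀ m n).eval 0 • (1 : Smooth n) := by
  have h : (Polynomial.X : Polynomial ℝ) ∣ p₀ m n - Polynomial.C ((p₀ m n).eval 0) := by
    simpa using Polynomial.X_sub_C_dvd_sub_C_eval (a := (0 : ℝ)) (p := p₀ m n)
  obtain ⟨q, hq⟩ := h
  rw [sub_eq_iff_eq_add] at hq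
  rw [P₀, hq, mul_comm]
  simp [Δ₀_one]

/-- The linearization of the `Q`-curvature increment operator is `α P₀ - β`, with this `α`. -/
noncomputable def linCoeff (m n : ℕ) : ℝ := if n = 2 * m then 1 else (n : ℝ) / 2 - m

/-- The linearization of the `Q`-curvature increment operator is `α P₀ - β`, with this `β`. -/
noncomputable def linConst (m n : ℕ) : ℝ :=
  if n = 2 * m then ((2 * m).factorial : ℝ) else ((n : ℝ) / 2 + m) * (p₀ m n).eval 0

/-- The polynomial `q` such that the linearization of the `Q`-curvature increment operator is
`q(Δ₀)`. -/
noncomputable def linPoly (m n : ℕ) : Polynomial ℝ :=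
  Polynomial.C (linCoeff m n) * p₀ m n - Polynomial.C (linConst m n)

theorem aeval_linPoly (m : ℕ) (v : Smooth n) :
    Polynomial.aeval (Δ₀ n) (linPoly m n) v = linCoeff m n • P₀ m n v - linConst m n • v := by
  simp [linPoly, P₀, Module.algebraMap_end_apply]

theorem isLinearizationAt_Qincr (m : ℕ) (hm : 0 < m) :
    IsLinearizationAt (Qincr m n) 0 (Polynomial.aeval (Δ₀ n) (linPoly m n)) := by
  intro v x
  rw [aeval_linPoly]
  change HasDerivAt _ (linCoeff m n * P₀ m n v x - linConst m n * v x) 0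
  have he (c : ℝ) : HasDerivAt (fun t : ℝ => Real.exp (c * (t * v x))) (c * v x) 0 := by
    have := (((hasDerivAt_id (0 : ℝ)).mul_const (v x)).const_mul c).exp
    simpa using this
  by_cases h : n = 2 * m
  · have hfact : ((2 * m).factorial : ℝ) = 2 * m * ((2 * m - 1).factorial : ℝ) := by
      rw [← Nat.mul_factorial_pred (by omega : 2 * m ≠ 0)]
      push_cast
      ring
    simp only [linCoeff, linConst, if_pos h, Qincr, Qcurv, zero_add, map_smul]
    have h2 : HasDerivAt (fun t : ℝ => ((2 * m - 1).factorial : ℝ) * 1 + t * P₀ m n v x)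
        (P₀ m n v x) 0 := by
      simpa using ((hasDerivAt_id (0 : ℝ)).mul_const (P₀ m n v x)).const_add
        (((2 * m - 1).factorial : ℝ) * 1)
    have h3 := ((he (-(2 * m))).mul h2).sub_const (Qcurv m n 0 x)
    rw [hfact]
    simp only [Qcurv, if_pos h] at h3
    refine h3.congr_deriv ?_
    simp
    ring
  · have hne : (n : ℝ) / 2 - m ≠ 0 := by
      intro h0
      apply h
      have : (n : ℝ) = 2 * m := by linarith
      exact_mod_cast this
    simp only [linCoeff, linConst, if_neg h, Qincr, Qcurv, P, zero_add, mul_one, ← smul_sub,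
      smul_smul, mul_inv_cancel₀ hne, one_smul]
    have h2 := hasDerivAt_P₀_sexp m (((n : ℝ) / 2 - m) • v) x
    have h3 := ((he (-((n : ℝ) / 2 + m))).mul h2).sub_const
      ((sexp (-((n : ℝ) / 2 + m) • (0 : Smooth n)) *
        P₀ m n (sexp (((n : ℝ) / 2 - m) • (0 : Smooth n)))) x)
    have h1 : P₀ m n 1 x = (p₀ m n).eval 0 := by
      rw [P₀_one]
      exact mul_one _
    have hs (t : ℝ) : (((n : ℝ) / 2 - m) * t) • v = t • ((n : ℝ) / 2 - m) • v := by
      rw [smul_smul, mul_comm]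
    simp only [hs, mul_smul (-((n : ℝ) / 2 + m))]
    refine h3.congr_deriv ?_
    rw [map_smul]
    change _ + _ * (((n : ℝ) / 2 - m) * P₀ m n v x) = _
    rw [zero_smul, sexp_zero, h1]
    simp
    ring

/-! ### Roots of the linearized symbol among the eigenvalues. -/

/-- `∏_{k=1}^m (s - k)(s + k - 1)`. -/
noncomputable def shiftedProd (m : ℕ) (s : ℝ) : ℝ :=
  ∏ k ∈ Finset.Icc 1 m, ((s - k) * (s + k - 1))

theorem shiftedProd_succ (m : ℕ) (s : ℝ) :
    shiftedProd (m + 1) s = shiftedProd m s * ((s - (m + 1)) * (s + m)) := by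
  rw [shiftedProd, Finset.prod_Icc_succ_top (by omega), shiftedProd]
  push_cast
  ring

/-- Formally the product is $\Gamma(s+m)/\Gamma(s-m)$. -/
theorem shiftedProd_recurrence (m : ℕ) (s : ℝ) :
    (s - m) * shiftedProd m (s + 1) = (s + m) * shiftedProd m s := by
  induction m with
  | zero => simp [shiftedProd]
  | succ m ih =>
    rw [shiftedProd_succ, shiftedProd_succ]
    push_cast
    linear_combination (s - (m + 1)) * (s + 1 + m) * ih

/-- The case $j=m$ identifies $(2m)!$ as the value at $s=m+1=\frac n2+1$ in the critical dimension.
-/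
theorem shiftedProd_mul_factorial (m j : ℕ) (hj : j ≤ m) :
    shiftedProd j (m + 1) * ((m - j).factorial : ℝ) = ((m + j).factorial : ℝ) := by
  induction j with
  | zero => simp [shiftedProd]
  | succ j ih =>
    have h1 := ih (by omega)
    obtain ⟨d, rfl⟩ : ∃ d, m = d + (j + 1) := ⟨m - (j + 1), by omega⟩
    rw [show d + (j + 1) - j = d + 1 by omega, Nat.factorial_succ] at h1
    rw [show d + (j + 1) - (j + 1) = d by omega, shiftedProd_succ,
      show d + (j + 1) + (j + 1) = d + (j + 1) + j + 1 by omega, Nat.factorial_succ]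
    push_cast at h1 ⊢
    rw [← h1]
    ring

/-- The `i`-th eigenvalue of `Δ₀` on `𝕊ⁿ`. -/
noncomputable def eigen (n i : ℕ) : ℝ := i * (i + n - 1)

theorem p₀_eval_eigen (m n i : ℕ) :
    (p₀ m n).eval (eigen n i) = shiftedProd m ((n : ℝ) / 2 + i) := by
  rw [p₀, Polynomial.eval_prod, shiftedProd]
  refine Finset.prod_congr rfl fun k _ => ?_
  simp [eigen]
  ring

/-- A zero factor forces $\frac n2+i=k\le m$, hence $n$ even and $n<2m$, which admissibility
excludes. The factors $s+k-1$ are positive. -/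
theorem shiftedProd_ne_zero {m n i : ℕ} (h : Admissible m n) (hi : 1 ≤ i) :
    shiftedProd m ((n : ℝ) / 2 + i) ≠ 0 := by
  refine Finset.prod_ne_zero_iff.mpr fun k hk => mul_ne_zero ?_ ?_
  · intro h0
    have h1 : (n : ℝ) + 2 * i = 2 * k := by linarith
    have h2 : n + 2 * i = 2 * k := by exact_mod_cast h1
    have h3 := h.le_of_even ⟨k - i, by omega⟩
    have := (Finset.mem_Icc.mp hk).2
    omega
  · have h1 : (1 : ℝ) ≤ k := by exact_mod_cast (Finset.mem_Icc.mp hk).1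
    have h2 : (1 : ℝ) ≤ i := by exact_mod_cast hi
    have h3 : (0 : ℝ) ≤ n := n.cast_nonneg
    linarith

/-- In the recurrence $|s-m|<s+m$ because $s,m>0$. Only the later value must be nonzero; at $i=0$
the product may vanish. -/
theorem abs_shiftedProd_lt {m n : ℕ} (h : Admissible m n) (i : ℕ) :
    |shiftedProd m ((n : ℝ) / 2 + i)| < |shiftedProd m ((n : ℝ) / 2 + (i + 1 : ℕ))| := by
  have h1 := shiftedProd_ne_zero h (Nat.succ_le_succ (Nat.zero_le i))
  have hrec := shiftedProd_recurrence m ((n : ℝ) / 2 + i)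
  rw [show (n : ℝ) / 2 + i + 1 = (n : ℝ) / 2 + (i + 1 : ℕ) by push_cast; ring] at hrec
  have hs : (0 : ℝ) < (n : ℝ) / 2 + i := by
    have := h.one_lt_n
    positivity
  have hm : (0 : ℝ) < m := by exact_mod_cast h.m_pos
  generalize (n : ℝ) / 2 + i = s at *
  have habs := congrArg abs hrec
  rw [abs_mul, abs_mul, abs_of_pos (by linarith : 0 < s + m)] at habs
  have h2 : |s - m| < s + m := abs_lt.mpr ⟨by linarith, by linarith⟩
  have h3 : |s - m| * |shiftedProd m ((n : ℝ) / 2 + (i + 1 : ℕ))| <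
      (s + m) * |shiftedProd m ((n : ℝ) / 2 + (i + 1 : ℕ))| :=
    mul_lt_mul_of_pos_right h2 (abs_pos.mpr h1)
  rw [habs] at h3
  exact lt_of_mul_lt_mul_left h3 (by linarith)

theorem shiftedProd_eq_iff {m n : ℕ} (h : Admissible m n) (i : ℕ) :
    shiftedProd m ((n : ℝ) / 2 + i) = shiftedProd m ((n : ℝ) / 2 + 1) ↔ i = 1 := by
  have hmono : StrictMono fun i : ℕ => |shiftedProd m ((n : ℝ) / 2 + i)| :=
    strictMono_nat_of_lt_succ (abs_shiftedProd_lt h)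
  constructor
  · intro h0
    refine hmono.injective ?_
    simp [h0]
  · rintro rfl
    simp

theorem linCoeff_ne_zero (m n : ℕ) : linCoeff m n ≠ 0 := by
  unfold linCoeff
  split_ifs with h
  · exact one_ne_zero
  · intro h0
    apply h
    have : (n : ℝ) = 2 * m := by linarith
    exact_mod_cast this

theorem linConst_eq (m n : ℕ) :
    linConst m n = linCoeff m n * shiftedProd m ((n : ℝ) / 2 + 1) := by
  unfold linConst linCoeff
  split_ifs with h
  · have := shiftedProd_mul_factorial m m le_rfl
    rw [Nat.sub_self, Nat.factorial_zero, Nat.cast_one, mul_one, ← two_mul] at this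
    rw [h, ← this]
    push_cast
    rw [mul_div_cancel_left₀ _ two_ne_zero, one_mul]
  · have h0 : (p₀ m n).eval 0 = shiftedProd m ((n : ℝ) / 2) := by
      simpa [eigen] using p₀_eval_eigen m n 0
    rw [h0, shiftedProd_recurrence]

theorem linPoly_eval_eigen {m n : ℕ} (h : Admissible m n) (i : ℕ) :
    (linPoly m n).eval (eigen n i) = 0 ↔ i = 1 := by
  rw [linPoly, Polynomial.eval_sub, Polynomial.eval_mul, Polynomial.eval_C, Polynomial.eval_C,
    p₀_eval_eigen, linConst_eq, sub_eq_zero, mul_right_inj' (linCoeff_ne_zero m n),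
    shiftedProd_eq_iff h]

/-! ### Symmetry of $\Delta_0$ by integration over $\mathbb R^{n+1}$. -/

open MeasureTheory

theorem integral_fderiv_apply_eq_zero {E : Type*} [NormedAddCommGroup E] [NormedSpace ℝ E]
    [FiniteDimensional ℝ E] [MeasurableSpace E] [BorelSpace E] (μ : Measure E)
    [μ.IsAddHaarMeasure] {H : E → ℝ} (hH : ContDiff ℝ 1 H) (hc : HasCompactSupport H) (v : E) :
    ∫ y, fderiv ℝ H y v ∂μ = 0 := by
  have hcont : Continuous fun y => fderiv ℝ H y v :=
    (hH.continuous_fderiv (by simp)).clm_apply continuous_const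
  have h := integral_mul_fderiv_eq_neg_fderiv_mul_of_integrable (μ := μ) (f := fun _ : E => (1 : ℝ))
    (g := H) (v := v) (by simp)
    (by simpa using hcont.integrable_of_hasCompactSupport (hc.fderiv_apply ℝ v))
    (by simpa using hH.continuous.integrable_of_hasCompactSupport hc)
    (fun y _ => differentiableAt_const _) (fun y _ => hH.differentiable (by simp) y)
  simpa using h

/-- Transfers identities between the sphere and $\mathbb R^{n+1}$: a radial weight splits off as a
one-dimensional factor. -/
theorem integral_polar (k : ℝ → ℝ) (h : Sph n → ℝ) :
    ∫ y : EuclideanSpace ℝ (Fin (n + 1)), k ‖y‖ * radialExt h y =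
      (∫ x, h x ∂(μ₀ n)) * ∫ r : Set.Ioi (0 : ℝ), k r ∂(Measure.volumeIoiPow n) := by
  have hd : Module.finrank ℝ (EuclideanSpace ℝ (Fin (n + 1))) - 1 = n := by simp
  set μ : Measure (EuclideanSpace ℝ (Fin (n + 1))) := volume with hμ
  have h1 : ∫ y, k ‖y‖ * radialExt h y ∂μ =
      ∫ y : ({0}ᶜ : Set (EuclideanSpace ℝ (Fin (n + 1)))), k ‖y.1‖ * radialExt h y.1
        ∂(μ.comap (↑)) := by
    rw [integral_subtype_comap (measurableSet_singleton _).compl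
      fun y => k ‖y‖ * radialExt h y, restrict_compl_singleton]
  have h2 := μ.measurePreserving_homeomorphUnitSphereProd.integral_comp
    (Homeomorph.measurableEmbedding _) (fun p => k p.2 * h p.1)
  have h3 := integral_prod_mul (μ := μ.toSphere)
    (ν := Measure.volumeIoiPow (Module.finrank ℝ (EuclideanSpace ℝ (Fin (n + 1))) - 1))
    (fun x => h x) (fun r => k r)
  rw [hd] at h2 h3
  rw [h1]
  refine Eq.trans (integral_congr_ae (Filter.Eventually.of_forall fun y => ?_)) (h2.trans ?_)
  · have hy : (y : EuclideanSpace ℝ (Fin (n + 1))) ≠ 0 := y.2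
    simp only [radialExt, hy, dite_false]
    congr 1
    · rw [homeomorphUnitSphereProd_apply_snd_coe]
    · congr 1
      ext1
      rw [homeomorphUnitSphereProd_apply_fst_coe]
  · exact (integral_congr_ae (Filter.Eventually.of_forall fun p => mul_comm _ _)).trans h3

/-- A smooth bump on the line, supported in `[1, 3]`. -/
noncomputable def bump : ContDiffBump (2 : ℝ) := ⟨1 / 2, 1, by norm_num, by norm_num⟩

theorem bump_eq_zero {t : ℝ} (ht : t ≤ 1 ∨ 3 ≤ t) : bump t = 0 := by
  refine bump.zero_of_le_dist ?_
  change (1 : ℝ) ≤ dist t 2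
  rw [Real.dist_eq, le_abs]
  rcases ht with h | h
  · right; linarith
  · left; linarith

theorem integral_bump_ne_zero (n : ℕ) :
    ∫ r : Set.Ioi (0 : ℝ), bump ((r : ℝ) ^ 2) ∂(Measure.volumeIoiPow n) ≠ 0 := by
  intro h0
  have h1 := integral_polar (n := n) (fun r => bump (r ^ 2)) (fun _ => 1)
  rw [h0, mul_zero] at h1
  have hcont : Continuous fun y : EuclideanSpace ℝ (Fin (n + 1)) => bump (‖y‖ ^ 2) :=
    bump.continuous.comp (continuous_norm.pow 2)
  have hcomp : HasCompactSupport fun y : EuclideanSpace ℝ (Fin (n + 1)) => bump (‖y‖ ^ 2) := by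
    refine HasCompactSupport.intro (isCompact_closedBall 0 2) fun y hy => bump_eq_zero (Or.inr ?_)
    rw [mem_closedBall_zero_iff, not_le] at hy
    nlinarith
  have hpos : 0 < ∫ y : EuclideanSpace ℝ (Fin (n + 1)), bump (‖y‖ ^ 2) := by
    -- A vector of squared norm $2$ sits at the centre of the bump.
    refine hcont.integral_pos_of_hasCompactSupport_nonneg_nonzero hcomp
      (fun y => bump.nonneg) (x := √2 • stdBasis n 0) ?_
    have : ‖√2 • stdBasis n 0‖ ^ 2 = 2 := by
      rw [norm_smul, (stdBasis n).norm_eq_one, mul_one, Real.norm_eq_abs, sq_abs,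
        Real.sq_sqrt (by norm_num)]
    rw [this]
    exact (bump.pos_of_mem_ball (Metric.mem_ball_self bump.rOut_pos)).ne'
  refine hpos.ne' (Eq.trans (integral_congr_ae (Filter.Eventually.of_forall fun y => ?_)) h1)
  by_cases hy : y = 0
  · simp [hy, bump_eq_zero]
  · simp [radialExt, hy]

/-- The extension is homogeneous of degree $0$, so its Laplacian is homogeneous of degree $-2$. -/
theorem laplacian_radialExt (g : Smooth n) {y : EuclideanSpace ℝ (Fin (n + 1))} (hy : y ≠ 0) :
    ‖y‖ ^ 2 * Laplacian.laplacian (radialExt g) y = -radialExt (Δ₀ n g) y := by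
  have hpos : 0 < ‖y‖ := norm_pos_iff.mpr hy
  have h : radialExt g = fun z => radialExt g (‖y‖⁻¹ • z) :=
    funext fun z => (radialExt_smul g (inv_pos.mpr hpos) z).symm
  rw [h, laplacian_comp_smul, ← mul_assoc, ← mul_pow, mul_inv_cancel₀ hpos.ne', one_pow, one_mul]
  simp only [radialExt, hy, dite_false, Δ₀_apply, neg_neg]

theorem fderiv_radialExt_self (g : Smooth n) {y : EuclideanSpace ℝ (Fin (n + 1))} (hy : y ≠ 0) :
    fderiv ℝ (radialExt g) y y = 0 := by
  have h1 := ((contDiffAt_radialExt g hy).differentiableAt (by simp)).hasFDerivAt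
  have h2 : HasDerivAt (fun t : ℝ => t • y) y 1 := by
    simpa using (hasDerivAt_id (1 : ℝ)).smul_const y
  have h3 : HasDerivAt (fun t : ℝ => radialExt g (t • y)) (fderiv ℝ (radialExt g) y y) 1 := by
    rw [← one_smul ℝ y] at h1
    have := h1.comp_hasDerivAt (1 : ℝ) h2
    rwa [one_smul] at this
  have h4 : (fun t : ℝ => radialExt g (t • y)) =ᶠ[nhds 1] fun _ => radialExt g y := by
    filter_upwards [lt_mem_nhds one_pos] with t ht using radialExt_smul g ht y
  exact h3.unique ((hasDerivAt_const _ _).congr_of_eventuallyEq h4)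

/-- The radial cut-off `y ↦ |y|² ψ(|y|²)`, with `ψ` a bump. -/
noncomputable def cutoff (y : EuclideanSpace ℝ (Fin (n + 1))) : ℝ := ‖y‖ ^ 2 * bump (‖y‖ ^ 2)

theorem contDiff_cutoff : ContDiff ℝ ∞ (cutoff (n := n)) :=
  (contDiff_norm_sq ℝ).mul (bump.contDiff.comp (contDiff_norm_sq ℝ))

theorem cutoff_eventually_zero :
    cutoff =ᶠ[nhds (0 : EuclideanSpace ℝ (Fin (n + 1)))] fun _ => 0 := by
  filter_upwards [Metric.ball_mem_nhds _ one_pos] with y hy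
  rw [mem_ball_zero_iff] at hy
  rw [cutoff, bump_eq_zero (Or.inl (by nlinarith [norm_nonneg y])), mul_zero]

theorem cutoff_zero_of_lt {y : EuclideanSpace ℝ (Fin (n + 1))} (hy : 2 < ‖y‖) : cutoff y = 0 := by
  rw [cutoff, bump_eq_zero (Or.inr (by nlinarith)), mul_zero]

theorem fderiv_cutoff (y : EuclideanSpace ℝ (Fin (n + 1))) :
    ∃ c : ℝ, fderiv ℝ cutoff y = c • innerSL ℝ y := by
  have h0 : HasFDerivAt (fun z : EuclideanSpace ℝ (Fin (n + 1)) => ‖z‖ ^ 2) (2 • innerSL ℝ y) y :=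
    (hasStrictFDerivAt_norm_sq y).hasFDerivAt
  have h1 : DifferentiableAt ℝ (fun t : ℝ => t * bump t) (‖y‖ ^ 2) :=
    (contDiff_id.mul (bump.contDiff (n := 1))).differentiable (by simp) _
  refine ⟨deriv (fun t : ℝ => t * bump t) (‖y‖ ^ 2) * 2, ?_⟩
  have h2 := (h1.hasDerivAt.comp_hasFDerivAt y h0).fderiv
  refine Eq.trans h2 ?_
  ext v
  simp
  ring

/-- The components of `φ (f ∇g - g ∇f)`, for the radial cut-off `φ` and the radial extensions of
`f` and `g`. -/
noncomputable def flux (f g : Smooth n) (i : Fin (n + 1))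
    (y : EuclideanSpace ℝ (Fin (n + 1))) : ℝ :=
  cutoff y * (radialExt f y * fderiv ℝ (radialExt g) y (stdBasis n i) -
    radialExt g y * fderiv ℝ (radialExt f) y (stdBasis n i))

theorem flux_eventually_zero (f g : Smooth n) (i : Fin (n + 1)) :
    flux f g i =ᶠ[nhds 0] fun _ => 0 := by
  filter_upwards [cutoff_eventually_zero (n := n)] with y hy
  rw [flux, hy, zero_mul]

theorem contDiff_flux (f g : Smooth n) (i : Fin (n + 1)) : ContDiff ℝ 1 (flux f g i) := by
  rw [contDiff_iff_contDiffAt]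
  intro y
  by_cases hy : y = 0
  · subst hy
    exact contDiffAt_const.congr_of_eventuallyEq (flux_eventually_zero f g i)
  · have hf := contDiffAt_radialExt f hy
    have hg := contDiffAt_radialExt g hy
    have hf' : ContDiffAt ℝ ∞ (fderiv ℝ (radialExt f)) y := hf.fderiv_right (by simp)
    have hg' : ContDiffAt ℝ ∞ (fderiv ℝ (radialExt g)) y := hg.fderiv_right (by simp)
    exact (contDiff_cutoff.contDiffAt.mul ((hf.mul (hg'.clm_apply contDiffAt_const)).sub
      (hg.mul (hf'.clm_apply contDiffAt_const)))).of_le (by simp)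

theorem hasCompactSupport_flux (f g : Smooth n) (i : Fin (n + 1)) :
    HasCompactSupport (flux f g i) := by
  refine HasCompactSupport.intro (isCompact_closedBall 0 2) fun y hy => ?_
  rw [mem_closedBall_zero_iff, not_le] at hy
  rw [flux, cutoff_zero_of_lt hy, zero_mul]

/-- The cut-off has radial gradient while the extensions have zero radial derivative, so it
differentiates away; the terms $\nabla f\cdot\nabla g$ cancel. -/
theorem sum_fderiv_flux (f g : Smooth n) {y : EuclideanSpace ℝ (Fin (n + 1))} (hy : y ≠ 0) :
    ∑ i, fderiv ℝ (flux f g i) y (stdBasis n i) =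
      cutoff y * (radialExt f y * Laplacian.laplacian (radialExt g) y -
        radialExt g y * Laplacian.laplacian (radialExt f) y) := by
  obtain ⟨c, hc⟩ := fderiv_cutoff y
  have hφ := (contDiff_cutoff (n := n)).contDiffAt (x := y) |>.differentiableAt (by simp)
    |>.hasFDerivAt
  have hf := contDiffAt_radialExt f hy |>.of_le two_le_infty
  have hg := contDiffAt_radialExt g hy |>.of_le two_le_infty
  have hf1 := (hf.differentiableAt (by simp)).hasFDerivAt
  have hg1 := (hg.differentiableAt (by simp)).hasFDerivAt
  have hf2 := (differentiableAt_fderiv hf).hasFDerivAt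
  have hg2 := (differentiableAt_fderiv hg).hasFDerivAt
  have hterm (i : Fin (n + 1)) : fderiv ℝ (flux f g i) y (stdBasis n i) =
      cutoff y * (radialExt f y * fderiv ℝ (fderiv ℝ (radialExt g)) y (stdBasis n i) (stdBasis n i) -
        radialExt g y * fderiv ℝ (fderiv ℝ (radialExt f)) y (stdBasis n i) (stdBasis n i)) +
      c * (radialExt f y * (inner ℝ y (stdBasis n i) * fderiv ℝ (radialExt g) y (stdBasis n i)) -
        radialExt g y * (inner ℝ y (stdBasis n i) * fderiv ℝ (radialExt f) y (stdBasis n i))) := by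
    have hconst := hasFDerivAt_const (𝕜 := ℝ) (stdBasis n i) y
    have h := (hφ.mul ((hf1.mul (hg2.clm_apply hconst)).sub
      (hg1.mul (hf2.clm_apply hconst)))).fderiv
    rw [hc] at h
    refine (congrArg (fun l : EuclideanSpace ℝ (Fin (n + 1)) →L[ℝ] ℝ => l (stdBasis n i)) h).trans
      ?_
    simp
    ring
  have hradial (h : Smooth n) :
      ∑ i, inner ℝ y (stdBasis n i) * fderiv ℝ (radialExt h) y (stdBasis n i) = 0 := by
    have h1 := congrArg (fderiv ℝ (radialExt h) y) ((stdBasis n).sum_repr' y)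
    rw [fderiv_radialExt_self h hy, map_sum] at h1
    rw [← h1]
    refine Finset.sum_congr rfl fun i _ => ?_
    rw [map_smul, smul_eq_mul, real_inner_comm]
  simp only [hterm, Finset.sum_add_distrib, ← Finset.mul_sum, Finset.sum_sub_distrib, hradial,
    laplacian_eq_sum_fderiv (stdBasis n)]
  ring

instance : IsFiniteMeasure (μ₀ n) := inferInstanceAs (IsFiniteMeasure (Measure.toSphere _))

theorem integrable_smooth (f : Smooth n) : Integrable (fun x => f x) (μ₀ n) :=
  f.contMDiff.continuous.integrable_of_hasCompactSupport (HasCompactSupport.of_compactSpace _)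

/-- The flux has integral-zero divergence. The factor $|y|^2$ of the cut-off absorbs the homogeneity
of the Laplacian, so polar coordinates give the desired sphere integral times a nonzero radial one.
-/
theorem isSelfAdjointL2_Δ₀ : IsSelfAdjointL2 (Δ₀ n) := by
  intro f g
  have h0 : ∑ i, ∫ y, fderiv ℝ (flux f g i) y (stdBasis n i) = 0 :=
    Finset.sum_eq_zero fun i _ =>
      integral_fderiv_apply_eq_zero volume (contDiff_flux f g i) (hasCompactSupport_flux f g i) _
  rw [← integral_finsetSum _ fun i _ =>
    (((contDiff_flux f g i).continuous_fderiv (by simp)).clm_apply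
      continuous_const).integrable_of_hasCompactSupport
        ((hasCompactSupport_flux f g i).fderiv_apply ℝ _)] at h0
  have h1 := integral_polar (n := n) (fun r => bump (r ^ 2))
    (fun x => Δ₀ n f x * g x - f x * Δ₀ n g x)
  have h2 : ∫ y : EuclideanSpace ℝ (Fin (n + 1)),
      bump (‖y‖ ^ 2) * radialExt (fun x => Δ₀ n f x * g x - f x * Δ₀ n g x) y = 0 := by
    rw [← h0]
    refine integral_congr_ae (Filter.Eventually.of_forall fun y => ?_)
    dsimp only
    by_cases hy : y = 0
    · subst hy
      have hz (i : Fin (n + 1)) : fderiv ℝ (flux f g i) 0 = 0 := by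
        rw [(flux_eventually_zero f g i).fderiv_eq]
        simp
      simp [hz, bump_eq_zero]
    · rw [sum_fderiv_flux f g hy]
      have hf := laplacian_radialExt f hy
      have hg := laplacian_radialExt g hy
      have hr : radialExt (fun x => Δ₀ n f x * g x - f x * Δ₀ n g x) y =
          radialExt (Δ₀ n f) y * radialExt g y - radialExt f y * radialExt (Δ₀ n g) y := by
        simp [radialExt, hy]
      rw [hr, cutoff]
      linear_combination bump (‖y‖ ^ 2) * (radialExt g y * hf - radialExt f y * hg)
  rw [h2] at h1
  have h3 := (mul_eq_zero.mp h1.symm).resolve_right (integral_bump_ne_zero n)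
  rw [integral_sub] at h3
  · linarith
  · exact integrable_smooth (Δ₀ n f * g)
  · exact integrable_smooth (f * Δ₀ n g)

/-! ### The $L^2$ pairing on smooth functions. -/

instance : (μ₀ n).IsOpenPosMeasure := inferInstanceAs (Measure.toSphere _).IsOpenPosMeasure

/-- The inner product of `L²(𝕊ⁿ, dμ₀)` on smooth functions. -/
noncomputable def l2Form (n : ℕ) : LinearMap.BilinForm ℝ (Smooth n) :=
  LinearMap.mk₂ ℝ (fun f g => ∫ x, f x * g x ∂(μ₀ n))
    (fun f f' g => by
      refine Eq.trans (integral_congr_ae (Filter.Eventually.of_forall fun x => add_mul _ _ _))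
        (integral_add (integrable_smooth (f * g)) (integrable_smooth (f' * g))))
    (fun c f g => by
      rw [smul_eq_mul, ← integral_const_mul]
      exact integral_congr_ae (Filter.Eventually.of_forall fun x => mul_assoc _ _ _))
    (fun f g g' => by
      refine Eq.trans (integral_congr_ae (Filter.Eventually.of_forall fun x => mul_add _ _ _))
        (integral_add (integrable_smooth (f * g)) (integrable_smooth (f * g'))))
    (fun c f g => by
      rw [smul_eq_mul, ← integral_const_mul]
      exact integral_congr_ae (Filter.Eventually.of_forall fun x => mul_left_comm _ _ _))

theorem eq_zero_of_l2Form_self {f : Smooth n} (h : l2Form n f f = 0) : f = 0 := by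
  by_contra hf
  obtain ⟨x, hx⟩ : ∃ x, f x ≠ 0 := by
    by_contra! h0
    exact hf (ContMDiffMap.ext h0)
  have hpos : 0 < ∫ x, f x * f x ∂(μ₀ n) :=
    Continuous.integral_pos_of_hasCompactSupport_nonneg_nonzero
      (f.contMDiff.continuous.mul f.contMDiff.continuous)
      (HasCompactSupport.of_compactSpace _) (fun x => mul_self_nonneg _) (mul_self_ne_zero.mpr hx)
  exact hpos.ne' h

/-- A definite form embeds $W$ in its dual, and equal finite dimensions make this onto. -/
theorem exists_l2Form_projection (W : Submodule ℝ (Smooth n)) [FiniteDimensional ℝ W]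
    (v : Smooth n) : ∃ w ∈ W, ∀ u ∈ W, l2Form n (v - w) u = 0 := by
  let φ : W →ₗ[ℝ] Module.Dual ℝ W := ((l2Form n).compl₁₂ W.subtype W.subtype)
  have hinj : Function.Injective φ := by
    rw [← LinearMap.ker_eq_bot, LinearMap.ker_eq_bot']
    intro w hw
    exact Subtype.ext (eq_zero_of_l2Form_self (LinearMap.congr_fun hw w))
  have hsurj : Function.Surjective φ :=
    (LinearMap.injective_iff_surjective_of_finrank_eq_finrank
      (Subspace.dual_finrank_eq (K := ℝ) (V := W)).symm).mp hinj
  obtain ⟨w, hw⟩ := hsurj ((l2Form n v).comp W.subtype)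
  refine ⟨w, w.2, fun u hu => ?_⟩
  have h := LinearMap.congr_fun hw ⟨u, hu⟩
  rw [map_sub, LinearMap.sub_apply, sub_eq_zero]
  exact h.symm

theorem isSelfAdjointL2_aeval_Δ₀ (p : Polynomial ℝ) :
    IsSelfAdjointL2 (Polynomial.aeval (Δ₀ n) p) := by
  change ∀ v w, l2Form n (Polynomial.aeval (Δ₀ n) p v) w = l2Form n v (Polynomial.aeval (Δ₀ n) p w)
  have hΔ : ∀ v w, l2Form n (Δ₀ n v) w = l2Form n v (Δ₀ n w) := isSelfAdjointL2_Δ₀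
  induction p using Polynomial.induction_on' with
  | add p q hp hq =>
    intro v w
    simp [hp, hq]
  | monomial k a =>
    intro v w
    simp only [Polynomial.aeval_monomial, Module.algebraMap_end_eq_smul_id, Module.End.mul_apply,
      LinearMap.smul_apply, LinearMap.id_apply, map_smul]
    congr 1
    induction k generalizing v w with
    | zero => rfl
    | succ k ih =>
      rw [pow_succ, Module.End.mul_apply, ih, hΔ, ← Module.End.mul_apply, ← pow_succ', pow_succ]

/-! ### Triangular action of $\Delta_0$ on polynomials. -/

theorem exists_aeval_sub_eval_smul {M : Type*} [AddCommGroup M] [Module ℝ M] (T : Module.End ℝ M)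
    (p : Polynomial ℝ) (a : ℝ) : ∃ r : Polynomial ℝ, ∀ v,
      Polynomial.aeval T p v - p.eval a • v = Polynomial.aeval T r (T v - a • v) := by
  obtain ⟨r, hr⟩ := Polynomial.X_sub_C_dvd_sub_C_eval (a := a) (p := p)
  have h := congrArg (Polynomial.aeval T) (hr.trans (mul_comm _ _))
  refine ⟨r, fun v => ?_⟩
  simpa [Module.algebraMap_end_apply] using LinearMap.congr_fun h v

/-- The restrictions to `𝕊ⁿ` of the polynomials of degree less than `k`. -/
noncomputable def polyLT (n : ℕ) : ℕ → Submodule ℝ (Smooth n)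
  | 0 => ⊥
  | k + 1 => Submodule.span ℝ {1} ⊔ polyLT n k ⊔
      ⨆ i : Fin (n + 1), (polyLT n k).map (LinearMap.mulLeft ℝ (coord i))

theorem polyLT_succ_le {k : ℕ} {S : Submodule ℝ (Smooth n)} (h1 : 1 ∈ S) (h2 : polyLT n k ≤ S)
    (h3 : ∀ i, ∀ g ∈ polyLT n k, coord i * g ∈ S) : polyLT n (k + 1) ≤ S := by
  refine sup_le (sup_le ?_ h2) (iSup_le fun i => ?_)
  · rwa [Submodule.span_singleton_le_iff_mem]
  · rintro _ ⟨g, hg, rfl⟩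
    exact h3 i g hg

theorem one_mem_polyLT (k : ℕ) : 1 ∈ polyLT n (k + 1) :=
  Submodule.mem_sup_left (Submodule.mem_sup_left (Submodule.mem_span_singleton_self 1))

theorem polyLT_le_succ (k : ℕ) : polyLT n k ≤ polyLT n (k + 1) :=
  le_sup_right.trans le_sup_left

theorem coord_mul_mem_polyLT {k : ℕ} (i : Fin (n + 1)) {g : Smooth n} (hg : g ∈ polyLT n k) :
    coord i * g ∈ polyLT n (k + 1) :=
  Submodule.mem_sup_right (Submodule.mem_iSup_of_mem i (Submodule.mem_map_of_mem hg))

theorem polyLT_mono : Monotone (polyLT n) := monotone_nat_of_le_succ polyLT_le_succ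

theorem polyLT_one : polyLT n 1 ≤ Submodule.span ℝ {1} := by
  refine polyLT_succ_le (Submodule.mem_span_singleton_self 1) bot_le fun i g hg => ?_
  rw [(Submodule.mem_bot ℝ).mp hg, mul_zero]
  exact Submodule.zero_mem _

theorem carre_one (f : Smooth n) : carre f 1 = 0 := by
  simp [carre, Δ₀_one]

/-- The linear map `g ↦ Γ(f, g)`. -/
noncomputable def carreLM (f : Smooth n) : Smooth n →ₗ[ℝ] Smooth n where
  toFun := carre f
  map_add' := carre_add f
  map_smul' c := carre_smul c f

/-- For $g$ homogeneous of degree $d$, $\langle\nabla x_i,\nabla g\rangle=\partial_i g-d\,x_ig$. The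
top degree in `polyLT n k` is $k-1$, so the added term cancels the leading part. -/
theorem carre_coord_add_mem {k : ℕ} (i : Fin (n + 1)) {g : Smooth n} (hg : g ∈ polyLT n k) :
    carre (coord i) g + ((k : ℝ) - 1) • (coord i * g) ∈ polyLT n k := by
  induction k generalizing g with
  | zero =>
    have : g = 0 := (Submodule.mem_bot ℝ).mp hg
    subst this
    have h0 : carre (coord i) (0 : Smooth n) = 0 := (carreLM (coord i)).map_zero
    simp [h0]
  | succ k ih =>
    let T : Smooth n →ₗ[ℝ] Smooth n := carreLM (coord i) +
      (((k + 1 : ℕ) : ℝ) - 1) • LinearMap.mulLeft ℝ (coord i)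
    refine polyLT_succ_le (S := (polyLT n (k + 1)).comap T) ?_ ?_ ?_ hg
    · change carre (coord i) 1 + (((k + 1 : ℕ) : ℝ) - 1) • (coord i * 1) ∈ polyLT n (k + 1)
      rw [carre_one, zero_add]
      cases k with
      | zero => simp
      | succ k => exact Submodule.smul_mem _ _ (coord_mul_mem_polyLT i (one_mem_polyLT k))
    · intro h hh
      change carre (coord i) h + (((k + 1 : ℕ) : ℝ) - 1) • (coord i * h) ∈ polyLT n (k + 1)
      convert Submodule.add_mem _ (polyLT_le_succ k (ih hh)) (coord_mul_mem_polyLT i hh) using 1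
      push_cast
      module
    · intro l h hh
      change carre (coord i) (coord l * h) + (((k + 1 : ℕ) : ℝ) - 1) • (coord i * (coord l * h)) ∈
        polyLT n (k + 1)
      convert Submodule.add_mem _ (coord_mul_mem_polyLT l (ih hh)) (Submodule.smul_mem _
        (if i = l then (1 : ℝ) else 0) (polyLT_le_succ k hh)) using 1
      rw [carre_mul, carre_coord]
      push_cast
      simp only [Algebra.smul_def, map_sub, map_add, map_one]
      ring

theorem Δ₀_sub_eigen_mem {k : ℕ} {g : Smooth n} (hg : g ∈ polyLT n (k + 1)) :
    Δ₀ n g - eigen n k • g ∈ polyLT n k := by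
  induction k generalizing g with
  | zero =>
    obtain ⟨c, rfl⟩ := Submodule.mem_span_singleton.mp (polyLT_one hg)
    simp [Δ₀_one, eigen]
  | succ k ih =>
    refine polyLT_succ_le
      (S := (polyLT n (k + 1)).comap (Δ₀ n - eigen n (k + 1) • LinearMap.id)) ?_ ?_ ?_ hg
    · change Δ₀ n 1 - eigen n (k + 1) • 1 ∈ polyLT n (k + 1)
      rw [Δ₀_one, zero_sub]
      exact Submodule.neg_mem _ (Submodule.smul_mem _ _ (one_mem_polyLT k))
    · intro h hh
      change Δ₀ n h - eigen n (k + 1) • h ∈ polyLT n (k + 1)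
      convert Submodule.add_mem _ (polyLT_le_succ k (ih hh))
        (Submodule.smul_mem _ (eigen n k - eigen n (k + 1)) hh) using 1
      module
    · intro i h hh
      change Δ₀ n (coord i * h) - eigen n (k + 1) • (coord i * h) ∈ polyLT n (k + 1)
      convert Submodule.sub_mem _ (coord_mul_mem_polyLT i (ih hh))
        (Submodule.smul_mem _ (2 : ℝ) (carre_coord_add_mem i hh)) using 1
      rw [Δ₀_mul, Δ₀_coord]
      -- Here $n$ comes from $\Delta_0x_i$, and $2k$ from $-2\langle\nabla x_i,\nabla h\rangle$
      -- modulo lower degree.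
      have h1 : eigen n (k + 1) = eigen n k + n + 2 * k := by
        simp only [eigen]
        push_cast
        ring
      rw [h1]
      push_cast
      simp only [Algebra.smul_def, map_sub, map_add, map_mul, map_one]
      ring

theorem Δ₀_mem_polyLT {k : ℕ} {g : Smooth n} (hg : g ∈ polyLT n k) : Δ₀ n g ∈ polyLT n k := by
  cases k with
  | zero =>
    rw [(Submodule.mem_bot ℝ).mp hg, map_zero]
    exact Submodule.zero_mem _
  | succ k =>
    rw [← sub_add_cancel (Δ₀ n g) (eigen n k • g)]
    exact Submodule.add_mem _ (polyLT_le_succ k (Δ₀_sub_eigen_mem hg)) (Submodule.smul_mem _ _ hg)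

theorem aeval_Δ₀_mem_polyLT (p : Polynomial ℝ) {k : ℕ} {g : Smooth n} (hg : g ∈ polyLT n k) :
    Polynomial.aeval (Δ₀ n) p g ∈ polyLT n k := by
  induction p using Polynomial.induction_on' with
  | add p q hp hq =>
    rw [map_add]
    exact Submodule.add_mem _ hp hq
  | monomial j a =>
    simp only [Polynomial.aeval_monomial, Module.algebraMap_end_eq_smul_id, Module.End.mul_apply,
      LinearMap.smul_apply, LinearMap.id_apply]
    refine Submodule.smul_mem _ _ ?_
    induction j with
    | zero => exact hg
    | succ j ih =>
      rw [pow_succ', Module.End.mul_apply]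
      exact Δ₀_mem_polyLT ih

theorem aeval_Δ₀_sub_eval_mem (p : Polynomial ℝ) {k : ℕ} {g : Smooth n}
    (hg : g ∈ polyLT n (k + 1)) :
    Polynomial.aeval (Δ₀ n) p g - p.eval (eigen n k) • g ∈ polyLT n k := by
  obtain ⟨r, hr⟩ := exists_aeval_sub_eval_smul (Δ₀ n) p (eigen n k)
  rw [hr g]
  exact aeval_Δ₀_mem_polyLT r (Δ₀_sub_eigen_mem hg)

/-- For $g$ of degree at most $k$, $q(\Delta_0)g-q(\lambda_k)g$ has lower degree, while $\langle
v,q(\Delta_0)g\rangle=\langle q(\Delta_0)v,g\rangle=0$; so $q(\lambda_k)\langle v,g\rangle=0$. -/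
theorem l2Form_polyLT_eq_zero {q : Polynomial ℝ} (hq : ∀ i, i ≠ 1 → q.eval (eigen n i) ≠ 0)
    {v : Smooth n} (hv : Polynomial.aeval (Δ₀ n) q v = 0) (hv1 : ∀ i, l2Form n v (coord i) = 0)
    (k : ℕ) : ∀ g ∈ polyLT n k, l2Form n v g = 0 := by
  induction k with
  | zero =>
    intro g hg
    rw [(Submodule.mem_bot ℝ).mp hg, map_zero]
  | succ k ih =>
    -- In degree $1$ division by $q(\lambda_1)$ is not available; orthogonality to the coordinates
    -- replaces it.
    by_cases hk : k = 1
    · subst hk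
      refine polyLT_succ_le (S := LinearMap.ker (l2Form n v)) (ih 1 (one_mem_polyLT 0)) ih ?_
      intro i g hg
      obtain ⟨c, rfl⟩ := Submodule.mem_span_singleton.mp (polyLT_one hg)
      rw [LinearMap.mem_ker, mul_smul_comm, mul_one, map_smul, hv1, smul_zero]
    · intro g hg
      have h1 := ih _ (aeval_Δ₀_sub_eval_mem q hg)
      have h2 : l2Form n v (Polynomial.aeval (Δ₀ n) q g) = 0 :=
        (isSelfAdjointL2_aeval_Δ₀ q v g).symm.trans
          (by rw [hv]; exact LinearMap.congr_fun (map_zero (l2Form n)) g)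
      rw [map_sub, h2, map_smul, zero_sub, neg_eq_zero, smul_eq_mul] at h1
      exact (mul_eq_zero.mp h1).resolve_left (hq k hk)

theorem exists_aeval_coord_mem_polyLT (p : MvPolynomial (Fin (n + 1)) ℝ) :
    ∃ k, MvPolynomial.aeval coord p ∈ polyLT n k := by
  induction p using MvPolynomial.induction_on with
  | C a =>
    refine ⟨1, ?_⟩
    rw [MvPolynomial.aeval_C, Algebra.algebraMap_eq_smul_one]
    exact Submodule.smul_mem _ _ (one_mem_polyLT 0)
  | add p q hp hq =>
    obtain ⟨k, hk⟩ := hp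
    obtain ⟨l, hl⟩ := hq
    refine ⟨max k l, ?_⟩
    rw [map_add]
    exact Submodule.add_mem _ (polyLT_mono (le_max_left k l) hk) (polyLT_mono (le_max_right k l) hl)
  | mul_X p i hp =>
    obtain ⟨k, hk⟩ := hp
    refine ⟨k + 1, ?_⟩
    rw [map_mul, MvPolynomial.aeval_X, mul_comm]
    exact coord_mul_mem_polyLT i hk

/-! ### Density of polynomials. -/

/-- The algebra of continuous functions on `𝕊ⁿ` that are restrictions of polynomials. -/
noncomputable def polySubalgebra (n : ℕ) : Subalgebra ℝ C(Sph n, ℝ) :=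
  (MvPolynomial.aeval fun i : Fin (n + 1) =>
    (⟨coord i, (coord i).contMDiff.continuous⟩ : C(Sph n, ℝ))).range

theorem polySubalgebra_dense : (polySubalgebra n).topologicalClosure = ⊤ := by
  refine ContinuousMap.subalgebra_topologicalClosure_eq_top_of_separatesPoints _ ?_
  intro x y hxy
  obtain ⟨i, hi⟩ : ∃ i, coord i x ≠ coord i y := by
    by_contra! h
    exact hxy (Subtype.ext (PiLp.ext h))
  exact ⟨_, ⟨_, ⟨MvPolynomial.X i, rfl⟩, rfl⟩, by simpa using hi⟩

theorem continuous_integral_mul (v : C(Sph n, ℝ)) :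
    Continuous fun f : C(Sph n, ℝ) => ∫ x, v x * f x ∂(μ₀ n) := by
  have h : Continuous fun f : C(Sph n, ℝ) =>
      ∫ x, ContinuousMap.toLp (E := ℝ) 1 (μ₀ n) ℝ (v * f) x ∂(μ₀ n) :=
    continuous_integral.comp ((ContinuousMap.toLp (E := ℝ) 1 (μ₀ n) ℝ).continuous.comp
      (continuous_const.mul continuous_id))
  refine h.congr fun f => integral_congr_ae ?_
  filter_upwards [ContinuousMap.coeFn_toLp (E := ℝ) (p := 1) (μ := μ₀ n) (𝕜 := ℝ) (v * f)] with x hx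
  rw [hx]
  rfl

theorem aeval_coord_apply (p : MvPolynomial (Fin (n + 1)) ℝ) (x : Sph n) :
    (MvPolynomial.aeval coord p : Smooth n) x = MvPolynomial.eval (fun i => coord i x) p := by
  change ContMDiffMap.evalRingHom x (MvPolynomial.aeval coord p) = _
  induction p using MvPolynomial.induction_on with
  | C a => rw [MvPolynomial.aeval_C, MvPolynomial.eval_C]; rfl
  | add p q hp hq => simp only [map_add, hp, hq]
  | mul_X p i hp => simp only [map_mul, hp, MvPolynomial.aeval_X, MvPolynomial.eval_X]; rfl

/-- Orthogonality to $v$ is closed under uniform limits, hence holds for $v$ itself. -/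
theorem eq_zero_of_l2Form_polynomial {v : Smooth n}
    (hv : ∀ p : MvPolynomial (Fin (n + 1)) ℝ, l2Form n v (MvPolynomial.aeval coord p) = 0) :
    v = 0 := by
  let S : Set C(Sph n, ℝ) := {f | ∫ x, v x * f x ∂(μ₀ n) = 0}
  have hS : IsClosed S :=
    isClosed_eq (continuous_integral_mul ⟨v, v.contMDiff.continuous⟩) continuous_const
  have hsub : (polySubalgebra n : Set C(Sph n, ℝ)) ⊆ S := by
    rintro _ ⟨p, rfl⟩
    refine Eq.trans (integral_congr_ae (Filter.Eventually.of_forall fun x => ?_)) (hv p)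
    dsimp only
    rw [aeval_coord_apply]
    congr 1
    induction p using MvPolynomial.induction_on with
    | C a => simp
    | add p q hp hq => simp_all
    | mul_X p i hp => simp_all
  have hmem : (⟨v, v.contMDiff.continuous⟩ : C(Sph n, ℝ)) ∈ S := by
    have h1 : closure (polySubalgebra n : Set C(Sph n, ℝ)) ⊆ S := closure_minimal hsub hS
    refine h1 ?_
    have h2 : (⟨v, v.contMDiff.continuous⟩ : C(Sph n, ℝ)) ∈
        (polySubalgebra n).topologicalClosure := by
      rw [polySubalgebra_dense]
      trivial
    exact h2
  exact eq_zero_of_l2Form_self hmem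

/-! ### First harmonics and the kernel. -/

theorem Λ_one_eq_span : Λ n 1 = Submodule.span ℝ (Set.range coord) := by
  apply le_antisymm
  · rintro f ⟨p, hp, -, hf⟩
    rw [← MvPolynomial.mem_homogeneousSubmodule, MvPolynomial.homogeneousSubmodule_one_eq_span_X,
      Submodule.mem_span_range_iff_exists_fun] at hp
    obtain ⟨c, rfl⟩ := hp
    rw [Submodule.mem_span_range_iff_exists_fun]
    refine ⟨c, ?_⟩
    ext x
    rw [hf x]
    change ContMDiffMap.evalRingHom x _ = _
    rw [map_sum, map_sum]
    refine Finset.sum_congr rfl fun i _ => ?_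
    rw [MvPolynomial.smul_eval, MvPolynomial.eval_X]
    rfl
  · rw [Submodule.span_le]
    rintro _ ⟨i, rfl⟩
    refine ⟨MvPolynomial.X i, MvPolynomial.isHomogeneous_X ℝ i, ?_, fun x => ?_⟩
    · refine Finset.sum_eq_zero fun j _ => ?_
      by_cases hij : i = j
      · subst hij
        simp
      · simp [MvPolynomial.pderiv_X_of_ne hij]
    · rw [MvPolynomial.eval_X]
      rfl

theorem linearIndependent_coord : LinearIndependent ℝ (coord (n := n)) := by
  rw [Fintype.linearIndependent_iff]
  intro c hc j
  let x : Sph n := ⟨stdBasis n j, by simp⟩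
  have h := congrArg (ContMDiffMap.evalRingHom x) hc
  rw [map_sum, map_zero] at h
  have h1 (i : Fin (n + 1)) : ContMDiffMap.evalRingHom x (c i • coord i) =
      c i * (if i = j then 1 else 0) := by
    change c i * (stdBasis n j) i = _
    simp
  simpa [h1] using h

theorem ker_linPoly {m : ℕ} (h : Admissible m n) :
    LinearMap.ker (Polynomial.aeval (Δ₀ n) (linPoly m n)) = Λ n 1 := by
  have hle : Λ n 1 ≤ LinearMap.ker (Polynomial.aeval (Δ₀ n) (linPoly m n)) := by
    rw [Λ_one_eq_span, Submodule.span_le]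
    rintro _ ⟨i, rfl⟩
    have h1 : Δ₀ n (coord i) = eigen n 1 • coord i := by simp [Δ₀_coord, eigen]
    rw [SetLike.mem_coe, LinearMap.mem_ker, Module.End.aeval_apply_of_mem_apply_eq_smul h1,
      (linPoly_eval_eigen h 1).mpr rfl, zero_smul]
  refine le_antisymm (fun v hv => ?_) hle
  rw [Λ_one_eq_span] at hle ⊢
  have := FiniteDimensional.span_of_finite ℝ (Set.finite_range (coord (n := n)))
  -- Removing the projection onto $\Lambda_1\subseteq\operatorname{Ker}L$ keeps $v$ in the kernel
  -- and makes it orthogonal to the coordinates.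
  obtain ⟨w, hw, hvw⟩ := exists_l2Form_projection (Submodule.span ℝ (Set.range coord)) v
  have hzero : v - w = 0 := by
    refine eq_zero_of_l2Form_polynomial fun p => ?_
    obtain ⟨k, hk⟩ := exists_aeval_coord_mem_polyLT p
    exact l2Form_polyLT_eq_zero (fun i hi => (linPoly_eval_eigen h i).not.mpr hi)
      (LinearMap.mem_ker.mp (Submodule.sub_mem _ hv (hle hw)))
      (fun i => hvw _ (Submodule.subset_span ⟨i, rfl⟩)) k _ hk
  rwa [sub_eq_zero.mp hzero]

end SphereQ

theorem lemma1 (m n : ℕ) (hmn : SphereQ.Admissible m n) :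
    ∃ L : SphereQ.Smooth n →ₗ[ℝ] SphereQ.Smooth n,
      SphereQ.IsLinearizationAt (SphereQ.Qincr m n) 0 L ∧
      SphereQ.IsSelfAdjointL2 L ∧
      LinearMap.ker L = SphereQ.Λ n 1 ∧
      Module.finrank ℝ (SphereQ.Λ n 1) = n + 1 := by
  refine ⟨Polynomial.aeval (SphereQ.Δ₀ n) (SphereQ.linPoly m n),
    SphereQ.isLinearizationAt_Qincr m hmn.m_pos, SphereQ.isSelfAdjointL2_aeval_Δ₀ _,
    SphereQ.ker_linPoly hmn, ?_⟩
  rw [SphereQ.Λ_one_eq_span, finrank_span_eq_card SphereQ.linearIndependent_coord,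
    Fintype.card_fin]
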